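/- Let $G$ be a locally compact abelian (Hausdorff) group with Haar measure $\mu_G$, let $U$ be a (weakly continuous) unitary representation of $G$ on a separable Hilbert space $\mathcal H$, and let $\phi\in\mathcal H$ be such that $\{U(t)\phi\}_{t\in G}$ is a continuous frame for $\mathcal H$ with respect to $(G,\mu_G)$. Let $H$ be a countable discrete subgroup of $G$ and let $\Phi=\{\varphi_1,\dots,\varphi_N\}\subset\mathcal H$ be such that $\{U(h)\varphi_n\}_{h\in H,\,1\le n\le N}$ is a Riesz sequence in $\mathcal H$. Put $$\mathcal H_\Phi=\Big\{\sum_{n=1}^N\sum_{h\in H}x_n(h)U(h)\varphi_n : x_n\in\ell^2(H)\Big\},\qquad \mathcal H_{U,\phi,\Phi}=\{F_f : f\in\mathcal H_\Phi\}\subset L^2(G),\quad F_f(s)=\langle f,U(s)\phi\rangle .$$ Let $R$ be a subgroup of $H$ of finite index $L$, let $h_1,\dots,h_L\in H$ be representatives of the cosets of $R$, and let $\varphi_{nl}=U(h_l)\varphi_n$. Let $A=[a_{m,nl}]$ be an $M\times NL$ matrix with entries in $\ell^2(R)$ whose entrywise Fourier transform $\widehat A$ has entries in $L^\infty(\widehat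 R)$ and satisfies $\operatorname{ess\,inf}_{\xi\in\widehat R}\det[\widehat A(\xi)^*\widehat A(\xi)]>0$. For $F=F_f\in\mathcal H_{U,\phi,\Phi}$, write $f=\sum_{n=1}^N\sum_{l=1}^L\sum_{r\in R}x_{nl}(r)U(r)\varphi_{nl}$ with $x_{nl}\in\ell^2(R)$, and define its generalized samples at $R$ by $$\mathcal L_mF(r)=\sum_{n=1}^N\sum_{l=1}^L\sum_{r'\in R}a_{m,nl}(r-r')\,x_{nl}(r'),\qquad r\in R,\ m=1,\dots,M .$$ Then $M\ge NL$, and there exist $M$ functions $S_1,\dots,S_M\in\mathcal H_{U,\phi,\Phi}$ such that, for every $F\in\mathcal H_{U,\phi,\Phi}$, $$F(s)=\sum_{m=1}^M\sum_{r\in R}\mathcal L_mF(r)\,S_m(s-r),\qquad s\in G,$$ where the series converges absolutely at each point of $G$, uniformly on $G$ (as the net of its finite partial sums), and in the norm of $L^2(G)$. Moreover, $\{S_m(\cdot-r)\}_{r\in R,\,1\le m\le M}$ is a frame for $\mathcal H_{U,\phi,\Phi}$ with respect to the inner product of $L^2(G)$. -/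

import Mathlib

open MeasureTheory Filter Topology
open scoped ENNReal ComplexConjugate Matrix

namespace UnitarySampling

noncomputable section

/-! ## Fourier analysis on a discrete abelian group -/

/-- The Hilbert space `ℓ²(Γ)` of square-summable complex functions on `Γ`. -/
abbrev EllTwo (Γ : Type*) : Type _ := lp (fun _ : Γ => ℂ) 2

/-- The group of (continuous) characters `Γ → 𝕋` of an additive topological group, with the
compact-open topology; it is compact when `Γ` is discrete. -/
abbrev DualGroup (Γ : Type*) [AddCommGroup Γ] [TopologicalSpace Γ] : Type _ :=
  PontryaginDual (Multiplicative Γ)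

section Fourier

variable {Γ : Type*} [AddCommGroup Γ] [TopologicalSpace Γ]

instance instMeasurableSpaceDualGroup : MeasurableSpace (DualGroup Γ) := borel _

instance instBorelSpaceDualGroup : BorelSpace (DualGroup Γ) := ⟨rfl⟩

/-- The pairing `(h, ξ) = ξ(h) ∈ 𝕋 ⊆ ℂ`. -/
def pairing (h : Γ) (ξ : DualGroup Γ) : ℂ := (ξ (Multiplicative.ofAdd h) : ℂ)

theorem continuous_pairing [DiscreteTopology Γ] (h : Γ) :
    Continuous (fun ξ : DualGroup Γ => pairing h ξ) := by
  have h1 : Continuous (fun f : Multiplicative Γ →ₜ* Circle =>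
      f.toContinuousMap (Multiplicative.ofAdd h)) :=
    (ContinuousEvalConst.continuous_eval_const (F := C(Multiplicative Γ, Circle))
      (Multiplicative.ofAdd h)).comp
      (ContinuousMonoidHom.isInducing_toContinuousMap _ _).continuous
  exact continuous_subtype_val.comp h1

/-- The continuous function `ξ ↦ conj (h, ξ) = (-h, ξ)` on the dual group. -/
def conjCharacter [DiscreteTopology Γ] (h : Γ) : C(DualGroup Γ, ℂ) :=
  ⟨fun ξ => conj (pairing h ξ), Complex.continuous_conj.comp (continuous_pairing h)⟩

/-- Haar measure of the compact dual group of a discrete group, normalized to total mass one. -/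
def dualHaar (Γ : Type*) [AddCommGroup Γ] [TopologicalSpace Γ] [DiscreteTopology Γ] :
    Measure (DualGroup Γ) :=
  Measure.haarMeasure ⊤

instance instIsProbabilityMeasureDualHaar [DiscreteTopology Γ] :
    IsProbabilityMeasure (dualHaar Γ) :=
  ⟨by
    have h := Measure.haarMeasure_self (K₀ := (⊤ : TopologicalSpace.PositiveCompacts (DualGroup Γ)))
    rwa [TopologicalSpace.PositiveCompacts.coe_top] at h⟩

instance instIsHaarMeasureDualHaar [DiscreteTopology Γ] : (dualHaar Γ).IsHaarMeasure := by
  unfold dualHaar; infer_instance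

/-- Characters separate the points of a discrete abelian group. -/
theorem exists_pairing_ne_one [DiscreteTopology Γ] {h : Γ} (hh : h ≠ 0) :
    ∃ ξ : DualGroup Γ, pairing h ξ ≠ 1 := by
  obtain ⟨c, hc⟩ := CharacterModule.exists_character_apply_ne_zero_of_ne_zero hh
  let g : ℚ →+ Additive Circle :=
    { toFun := fun q => Additive.ofMul (Circle.exp (2 * Real.pi * (q : ℝ)))
      map_zero' := by simp
      map_add' := fun p q => by
        rw [← ofMul_mul, ← Circle.exp_add]
        push_cast
        ring_nf }
  have hg1 : ∀ q : ℚ, g q = 0 ↔ ∃ n : ℤ, (n : ℚ) = q := fun q => by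
    have h1 : g q = 0 ↔ Circle.exp (2 * Real.pi * (q : ℝ)) = 1 := Iff.rfl
    rw [h1, Circle.exp_eq_one]
    refine exists_congr fun n => ?_
    have hpi := Real.pi_pos.ne'
    constructor
    · intro h2
      have h3 : (q : ℝ) = n := by
        have : (2 * Real.pi) * (q : ℝ) = (2 * Real.pi) * n := by rw [h2]; ring
        exact mul_left_cancel₀ (by positivity) this
      exact_mod_cast h3.symm
    · rintro rfl
      push_cast
      ring
  have hg : AddSubgroup.zmultiples (1 : ℚ) ≤ g.ker := by
    rintro q ⟨n, rfl⟩
    exact (hg1 _).2 ⟨n, by simp⟩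
  let g' : AddCircle (1 : ℚ) →+ Additive Circle := QuotientAddGroup.lift _ g hg
  let c' : Γ →+ AddCircle (1 : ℚ) := c
  let χ : Multiplicative Γ →* Circle := AddMonoidHom.toMultiplicativeLeft (g'.comp c')
  refine ⟨(⟨χ, continuous_of_discreteTopology⟩ : Multiplicative Γ →ₜ* Circle), fun h1 => hc ?_⟩
  have h2 : χ (Multiplicative.ofAdd h) = 1 := by
    ext
    exact h1
  have h3 : g' (c' h) = 0 := h2
  change c' h = 0
  obtain ⟨q, hq⟩ := QuotientAddGroup.mk_surjective (c' h)
  rw [← hq] at h3 ⊢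
  obtain ⟨n, rfl⟩ := (hg1 q).1 h3
  rw [QuotientAddGroup.eq_zero_iff]
  exact ⟨n, by simp⟩

/-- The conjugate characters, as elements of `L²` of the dual group. -/
def characterL2 [DiscreteTopology Γ] (h : Γ) : Lp ℂ 2 (dualHaar Γ) :=
  ContinuousMap.toLp 2 (dualHaar Γ) ℂ (conjCharacter h)

theorem orthonormal_characterL2 [DiscreteTopology Γ] :
    Orthonormal ℂ (characterL2 : Γ → Lp ℂ 2 (dualHaar Γ)) := by
  have hin : ∀ g h : Γ, inner ℂ (characterL2 g) (characterL2 h) =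
      ∫ ξ, pairing (g - h) ξ ∂(dualHaar Γ) := fun g h => by
    rw [characterL2, characterL2, ContinuousMap.inner_toLp]
    refine integral_congr_ae (ae_of_all _ fun ξ => ?_)
    simp [conjCharacter, pairing, ofAdd_sub, div_eq_mul_inv, mul_comm,
      ← Circle.coe_inv_eq_conj]
  have hself : ∀ g : Γ, inner ℂ (characterL2 g) (characterL2 g) = (1 : ℂ) := fun g => by
    rw [hin]
    simp [pairing]
  refine ⟨fun g => ?_, fun g h hgh => ?_⟩
  · have h1 := inner_self_eq_norm_sq_to_K (𝕜 := ℂ) (characterL2 g)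
    rw [hself] at h1
    have h2 : ‖characterL2 g‖ ^ 2 = 1 := by
      rw [← Complex.ofReal_inj]
      push_cast
      exact h1.symm
    exact (pow_eq_one_iff_of_nonneg (norm_nonneg _) two_ne_zero).1 h2
  · change inner ℂ (characterL2 g) (characterL2 h) = 0
    obtain ⟨η, hη⟩ := exists_pairing_ne_one (sub_ne_zero.2 hgh)
    rw [hin]
    have h1 := integral_mul_left_eq_self (μ := dualHaar Γ) (fun ξ => pairing (g - h) ξ) η
    have h2 : ∀ ξ, pairing (g - h) (η * ξ) = pairing (g - h) η * pairing (g - h) ξ := fun ξ =>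
      congrArg (fun z : Circle => (z : ℂ)) (ContinuousMonoidHom.mul_apply η ξ _)
    simp only [h2] at h1
    rw [integral_const_mul] at h1
    have h3 : (pairing (g - h) η - 1) * ∫ ξ, pairing (g - h) ξ ∂(dualHaar Γ) = 0 := by
      rw [sub_mul, h1, one_mul, sub_self]
    exact (mul_eq_zero.1 h3).resolve_left (sub_ne_zero.2 hη)

/-- The Fourier (Plancherel) transform `ℓ²(Γ) → L²(Γ̂)`, `a ↦ ∑ h, a(h) conj (h, ·)`, the series
being convergent in `L²(Γ̂)`: the isometric extension to `ℓ²(Γ)` of the Fourier transform on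
`ℓ¹(Γ)`; see `fourier_of_summable`. -/
def fourier [DiscreteTopology Γ] : EllTwo Γ →ₗᵢ[ℂ] Lp ℂ 2 (dualHaar Γ) :=
  (orthonormal_characterL2 (Γ := Γ)).orthogonalFamily.linearIsometry

theorem hasSum_fourier [DiscreteTopology Γ] (a : EllTwo Γ) :
    HasSum (fun h : Γ => a h • characterL2 h) (fourier a) := by
  have h := (orthonormal_characterL2 (Γ := Γ)).orthogonalFamily.hasSum_linearIsometry a
  simpa [fourier, LinearIsometry.toSpanSingleton_apply] using h

/-- On `ℓ¹(Γ)` the transform is given by the classical formula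
`â(ξ) = ∑ h, a(h) conj (h, ξ)`. -/
theorem fourier_of_summable [DiscreteTopology Γ] (a : EllTwo Γ) (ha : Summable fun h => ‖a h‖) :
    (fourier a : DualGroup Γ → ℂ) =ᵐ[dualHaar Γ] fun ξ => ∑' h : Γ, a h * conj (pairing h ξ) := by
  have hs : Summable fun h : Γ => a h • (conjCharacter h : C(DualGroup Γ, ℂ)) := by
    refine Summable.of_norm_bounded ha fun h => ?_
    rw [norm_smul]
    refine mul_le_of_le_one_right (norm_nonneg _) ?_
    refine (ContinuousMap.norm_le _ zero_le_one).2 fun ξ => ?_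
    simp [conjCharacter, pairing, Circle.norm_coe]
  have h1 := hs.hasSum.mapL (ContinuousMap.toLp (E := ℂ) 2 (dualHaar Γ) ℂ)
  have h2 : fourier a = ContinuousMap.toLp (E := ℂ) 2 (dualHaar Γ) ℂ
      (∑' h : Γ, a h • (conjCharacter h : C(DualGroup Γ, ℂ))) := by
    refine (hasSum_fourier a).unique ?_
    simpa [characterL2] using h1
  rw [h2]
  filter_upwards [ContinuousMap.coeFn_toLp (p := 2) (𝕜 := ℂ) (dualHaar Γ)
    (∑' h : Γ, a h • (conjCharacter h : C(DualGroup Γ, ℂ)))] with ξ hξ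
  rw [hξ]
  exact (ContinuousMap.tsum_apply hs ξ).symm

/-- The transfer matrix `Â(ξ) = [â_{m,n}(ξ)]` of a matrix with entries in `ℓ²(Γ)`. -/
def transferMatrix [DiscreteTopology Γ] {κ ι : Type*} (A : Matrix κ ι (EllTwo Γ))
    (ξ : DualGroup Γ) : Matrix κ ι ℂ :=
  Matrix.of fun m n => (fourier (A m n) : DualGroup Γ → ℂ) ξ

/-- The two conditions on the matrix of a stable sampling procedure: its transfer matrix has
entries in `L^∞(Γ̂)`, and `δ_A := ess inf_ξ det [Â(ξ)^* Â(ξ)] > 0`. (The determinant is a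
nonnegative real number.) -/
structure IsStableMatrix [DiscreteTopology Γ] {κ ι : Type*} [Fintype κ] [Fintype ι]
    [DecidableEq ι] (A : Matrix κ ι (EllTwo Γ)) : Prop where
  memLp_top : ∀ m n, MemLp (fourier (A m n) : DualGroup Γ → ℂ) ∞ (dualHaar Γ)
  essInf_det_pos : 0 < essInf
    (fun ξ : DualGroup Γ => ((transferMatrix A ξ)ᴴ * transferMatrix A ξ).det.re) (dualHaar Γ)

/-- Matrix convolution: `(A ∗ x)_m(t) = ∑ n, (a_{m,n} ∗ x_n)(t)`, with
`(a ∗ x)(t) = ∑ s, a(t - s) x(s)`. -/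
def matrixConv {κ ι : Type*} [Fintype ι] (A : Matrix κ ι (EllTwo Γ)) (x : ι → EllTwo Γ)
    (m : κ) (t : Γ) : ℂ :=
  ∑ n, ∑' s : Γ, A m n (t - s) * x n s

end Fourier

/-! ## Unitary representations, frames and Riesz sequences -/

/-- A (weakly continuous) unitary representation of `G` on `E`. -/
structure UnitaryRep (G E : Type*) [AddCommGroup G] [TopologicalSpace G]
    [NormedAddCommGroup E] [InnerProductSpace ℂ E] where
  toFun : G → E ≃ₗᵢ[ℂ] E
  map_zero : ∀ x, toFun 0 x = x
  map_add : ∀ s t x, toFun (s + t) x = toFun s (toFun t x)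
  continuous_inner : ∀ x y : E, Continuous fun t => inner ℂ y (toFun t x)

instance instCoeFunUnitaryRep (G E : Type*) [AddCommGroup G] [TopologicalSpace G]
    [NormedAddCommGroup E] [InnerProductSpace ℂ E] :
    CoeFun (UnitaryRep G E) (fun _ => G → E ≃ₗᵢ[ℂ] E) := ⟨UnitaryRep.toFun⟩

section Frames

variable {E : Type*} [NormedAddCommGroup E] [InnerProductSpace ℂ E]

/-- `ψ : Ω → E` is a continuous frame for `E` with respect to `(Ω, μ)`. -/
structure IsContinuousFrame {Ω : Type*} [MeasurableSpace Ω] (μ : Measure Ω) (ψ : Ω → E) :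
    Prop where
  measurable : ∀ x : E, Measurable fun w => inner ℂ (ψ w) x
  bounds : ∃ a b : ℝ, 0 < a ∧ a ≤ b ∧ ∀ x : E,
    ENNReal.ofReal (a * ‖x‖ ^ 2) ≤ ∫⁻ w, ‖inner ℂ (ψ w) x‖ₑ ^ 2 ∂μ ∧
    ∫⁻ w, ‖inner ℂ (ψ w) x‖ₑ ^ 2 ∂μ ≤ ENNReal.ofReal (b * ‖x‖ ^ 2)

/-- `e` is a Riesz sequence in `E`, i.e. a Riesz basis for its closed linear span. -/
def IsRieszSequence {κ : Type*} (e : κ → E) : Prop :=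
  ∃ a b : ℝ, 0 < a ∧ a ≤ b ∧ ∀ (s : Finset κ) (c : κ → ℂ),
    a * ∑ k ∈ s, ‖c k‖ ^ 2 ≤ ‖∑ k ∈ s, c k • e k‖ ^ 2 ∧
    ‖∑ k ∈ s, c k • e k‖ ^ 2 ≤ b * ∑ k ∈ s, ‖c k‖ ^ 2

/-- `e` is a (discrete) frame for the subspace `V` of `L²(μ)`, with respect to the inner product
`⟨F, S⟩ = ∫ F conj S dμ`. -/
structure IsFrameInL2 {Ω κ : Type*} [MeasurableSpace Ω] (μ : Measure Ω) (V : Set (Ω → ℂ))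
    (e : κ → Ω → ℂ) : Prop where
  memLp : ∀ F ∈ V, MemLp F 2 μ
  mem : ∀ k, e k ∈ V
  bounds : ∃ a b : ℝ, 0 < a ∧ a ≤ b ∧ ∀ F ∈ V,
    ENNReal.ofReal a * ∫⁻ t, ‖F t‖ₑ ^ 2 ∂μ ≤ ∑' k, ‖∫ t, F t * conj (e k t) ∂μ‖ₑ ^ 2 ∧
    ∑' k, ‖∫ t, F t * conj (e k t) ∂μ‖ₑ ^ 2 ≤ ENNReal.ofReal b * ∫⁻ t, ‖F t‖ₑ ^ 2 ∂μ

end Frames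

/-! ## The spaces `ℋ_Φ` and `ℋ_{U,φ,Φ}`, and generalized sampling

Below `j : Γ →+ G` is the inclusion of a subgroup. -/

section Spaces

variable {G E Γ ι : Type*} [AddCommGroup G] [TopologicalSpace G]
  [NormedAddCommGroup E] [InnerProductSpace ℂ E] [AddCommGroup Γ]

/-- The family `U(h) φ_n`, indexed by `(n, h)`. -/
def orbit (U : UnitaryRep G E) (j : Γ →+ G) (Φ : ι → E) (p : ι × Γ) : E := U (j p.2) (Φ p.1)

/-- `f = ∑ n, ∑ h, x_n(h) U(h) φ_n`, with (unconditional) convergence in `E`. -/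
def HasExpansion (U : UnitaryRep G E) (j : Γ →+ G) (Φ : ι → E) (x : ι → EllTwo Γ) (f : E) :
    Prop :=
  HasSum (fun p : ι × Γ => x p.1 p.2 • orbit U j Φ p) f

/-- The subspace `ℋ_Φ` of all `∑ n, ∑ h, x_n(h) U(h) φ_n` with `x_n ∈ ℓ²(Γ)`. -/
def generatedSpace (U : UnitaryRep G E) (j : Γ →+ G) (Φ : ι → E) : Set E :=
  {f | ∃ x : ι → EllTwo Γ, HasExpansion U j Φ x f}

/-- The function `F_f(t) = ⟨f, U(t) φ⟩`. -/
def analysisFun (U : UnitaryRep G E) (ϕ f : E) (t : G) : ℂ := inner ℂ (U t ϕ) f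

/-- The space `ℋ_{U,φ,Φ} = {F_f : f ∈ ℋ_Φ}` of functions on `G`. -/
def rangeSpace (U : UnitaryRep G E) (ϕ : E) (j : Γ →+ G) (Φ : ι → E) : Set (G → ℂ) :=
  analysisFun U ϕ '' generatedSpace U j Φ

open Classical in
/-- The coefficients `x_n ∈ ℓ²(Γ)` with `F = F_f`, `f = ∑ n, ∑ h, x_n(h) U(h) φ_n`, of a function
`F` of `ℋ_{U,φ,Φ}`; they are unique in the situation of interest, see `coefficients_eq`. -/
def coefficients (U : UnitaryRep G E) (ϕ : E) (j : Γ →+ G) (Φ : ι → E) (F : G → ℂ) :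
    ι → EllTwo Γ :=
  if h : ∃ (x : ι → EllTwo Γ) (f : E), HasExpansion U j Φ x f ∧ analysisFun U ϕ f = F
  then h.choose else 0

/-- The generalized samples `ℒ_m F(t) = (A ∗ x)_m(t)`, `t ∈ Γ`, of `F ∈ ℋ_{U,φ,Φ}`, where `x` are
the coefficients of `F`. -/
def sample [Fintype ι] {κ : Type*} (U : UnitaryRep G E) (ϕ : E) (j : Γ →+ G) (Φ : ι → E)
    (A : Matrix κ ι (EllTwo Γ)) (F : G → ℂ) (m : κ) (t : Γ) : ℂ :=
  matrixConv A (coefficients U ϕ j Φ F) m t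

theorem coefficients_eq [MeasurableSpace G] {μ : Measure G} {U : UnitaryRep G E} {ϕ : E}
    (hϕ : IsContinuousFrame μ fun t => U t ϕ) {j : Γ →+ G} {Φ : ι → E}
    (hΦ : IsRieszSequence (orbit U j Φ)) {x : ι → EllTwo Γ} {f : E}
    (hx : HasExpansion U j Φ x f) : coefficients U ϕ j Φ (analysisFun U ϕ f) = x := by
  have hex : ∃ (y : ι → EllTwo Γ) (g : E),
      HasExpansion U j Φ y g ∧ analysisFun U ϕ g = analysisFun U ϕ f := ⟨x, f, hx, rfl⟩
  have hc : coefficients U ϕ j Φ (analysisFun U ϕ f) = hex.choose := dif_pos hex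
  obtain ⟨g, hy, hgf⟩ := hex.choose_spec
  rw [hc]
  generalize hex.choose = y at hy
  have hfg : g = f := by
    obtain ⟨a, b, ha, -, hab⟩ := hϕ.bounds
    have h0 := (hab (g - f)).1
    have hz : ∀ w : G, inner ℂ (U w ϕ) (g - f) = 0 := fun w => by
      rw [inner_sub_right, sub_eq_zero]
      exact congrFun hgf w
    simp only [hz, enorm_zero, ne_eq, OfNat.ofNat_ne_zero, not_false_eq_true, zero_pow,
      lintegral_zero, nonpos_iff_eq_zero, ENNReal.ofReal_eq_zero] at h0
    have h1 : ‖g - f‖ ^ 2 ≤ 0 := by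
      by_contra hcon
      push Not at hcon
      have := mul_pos ha hcon
      linarith
    have h2 : ‖g - f‖ = 0 := by
      have := sq_nonneg ‖g - f‖
      exact pow_eq_zero_iff (two_ne_zero) |>.1 (le_antisymm h1 this)
    exact sub_eq_zero.1 (norm_eq_zero.1 h2)
  subst hfg
  obtain ⟨a, b, ha, -, hab⟩ := hΦ
  have hd : HasSum (fun p : ι × Γ => (y p.1 p.2 - x p.1 p.2) • orbit U j Φ p) 0 := by
    have := HasSum.sub hy hx
    simpa [sub_smul] using this
  have hlim := (hd.norm.pow 2)
  ext n t
  by_contra hne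
  have hpos : 0 < ‖y n t - x n t‖ ^ 2 := by
    have := norm_pos_iff.2 (sub_ne_zero.2 hne)
    positivity
  have hle : a * ‖y n t - x n t‖ ^ 2 ≤ 0 := by
    refine ge_of_tendsto (x := atTop) (by simpa using hlim) ?_
    filter_upwards [eventually_ge_atTop ({(n, t)} : Finset (ι × Γ))] with T hT
    refine le_trans ?_ (hab T fun p => y p.1 p.2 - x p.1 p.2).1
    refine mul_le_mul_of_nonneg_left ?_ ha.le
    exact Finset.single_le_sum (f := fun p : ι × Γ => ‖y p.1 p.2 - x p.1 p.2‖ ^ 2)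
      (fun _ _ => by positivity) (hT (Finset.mem_singleton_self _))
  have := mul_pos ha hpos
  linarith

end Spaces

end

end UnitarySampling

open UnitarySampling

/-! The Fourier transform turns convolution by `A` into multiplication by the transfer matrix `Â`.
The lower bound on `det (Âᴴ Â)` makes the left inverse `(Âᴴ Â)⁻¹ Âᴴ` essentially bounded, so the
sampling operator on `ℓ²` has a bounded left inverse `B` that commutes with translations. Expanding
`x = B (A ∗ x)` along the unit vectors writes `x` as the sum of its samples times translates of
finitely many vectors. The synthesis operator of the Riesz sequence followed by the analysis
operator of the continuous frame is bounded and bounded below, and intertwines the translations, so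
it carries this expansion, as well as the frame property of the translates, to functions on `G`.
Coset representatives of `R` reindex the orbit of `Φ` under `H` as an orbit under `R`. -/

namespace UnitarySampling

section EllTwo

variable {K K' ι Γ : Type*}

theorem hasSum_norm_sq (c : EllTwo K) : HasSum (fun k => ‖c k‖ ^ 2) (‖c‖ ^ 2) := by
  simpa using lp.hasSum_norm (p := 2) (by simp) c

theorem memℓp_two_of_summable {c : K → ℂ} (hc : Summable fun k => ‖c k‖ ^ 2) : Memℓp c 2 :=
  memℓp_gen (by simpa using hc)

theorem enorm_sq_eq_ofReal {F : Type*} [SeminormedAddGroup F] (x : F) :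
    ‖x‖ₑ ^ 2 = ENNReal.ofReal (‖x‖ ^ 2) := by
  rw [ENNReal.ofReal_pow (norm_nonneg _), ofReal_norm]

theorem tsum_enorm_sq (c : EllTwo K) : ∑' k, ‖c k‖ₑ ^ 2 = ‖c‖ₑ ^ 2 := by
  simp only [enorm_sq_eq_ofReal]
  rw [← ENNReal.ofReal_tsum_of_nonneg (fun _ => by positivity) (hasSum_norm_sq c).summable,
    (hasSum_norm_sq c).tsum_eq]

theorem hasSum_map_single [DecidableEq K] {F : Type*} [NormedAddCommGroup F] [NormedSpace ℂ F]
    (T : EllTwo K →L[ℂ] F) (c : EllTwo K) :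
    HasSum (fun k => c k • T (lp.single 2 k (1 : ℂ))) (T c) := by
  refine ((lp.hasSum_single (p := 2) (by simp) c).mapL T).congr_fun fun k => ?_
  rw [← map_smul, ← lp.single_smul, smul_eq_mul, mul_one]

/-- Composition with an injection of index sets, as a contraction `ℓ²(K) → ℓ²(K')`. -/
noncomputable def ellTwoComap (v : K' → K) (hv : Function.Injective v) :
    EllTwo K →L[ℂ] EllTwo K' :=
  LinearMap.mkContinuous
    { toFun c := ⟨c ∘ v, memℓp_two_of_summable
        ((hasSum_norm_sq c).summable.comp_injective hv)⟩
      map_add' _ _ := rfl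
      map_smul' _ _ := rfl } 1 fun c => by
    rw [one_mul, ← sq_le_sq₀ (norm_nonneg _) (norm_nonneg _)]
    exact hasSum_le_inj v hv (fun _ _ => by positivity) (fun _ => le_rfl)
      (hasSum_norm_sq (K := K') ⟨c ∘ v, _⟩) (hasSum_norm_sq c)

theorem ellTwoComap_apply {v : K' → K} (hv : Function.Injective v) (c : EllTwo K) (k : K') :
    ellTwoComap v hv c k = c (v k) := rfl

/-- Translation by `r` in the second variable, `c ↦ c(·, · - r)`. -/
noncomputable def ellTwoTranslate [AddCommGroup Γ] (r : Γ) : EllTwo (ι × Γ) →L[ℂ] EllTwo (ι × Γ) :=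
  ellTwoComap (fun p => (p.1, p.2 - r)) (Function.Injective.prodMap Function.injective_id
    (sub_left_injective (b := r)))

theorem ellTwoTranslate_apply [AddCommGroup Γ] (r : Γ) (c : EllTwo (ι × Γ)) (i : ι) (t : Γ) :
    ellTwoTranslate r c (i, t) = c (i, t - r) := rfl

/-- The identification of `ℓ²(ι × Γ)` with the finite power `ℓ²(Γ)^ι`. -/
noncomputable def ellTwoCurry (ι Γ : Type*) [Fintype ι] :
    EllTwo (ι × Γ) ≃L[ℂ] (ι → EllTwo Γ) :=
  ContinuousLinearEquiv.ofBijective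
    (ContinuousLinearMap.pi fun i => ellTwoComap (Prod.mk i) (Prod.mk_right_injective i))
    (LinearMap.ker_eq_bot.2 fun _ _ hcd => lp.ext <| funext fun p =>
      congrArg (fun x : ι → EllTwo Γ => x p.1 p.2) hcd)
    (LinearMap.range_eq_top.2 fun x => by
      have summable : Summable fun p : ι × Γ => ‖x p.1 p.2‖ ^ 2 :=
        (summable_prod_of_nonneg fun _ => by positivity).2
          ⟨fun i => (hasSum_norm_sq (x i)).summable, Summable.of_finite⟩
      exact ⟨⟨fun p => x p.1 p.2, memℓp_two_of_summable summable⟩, rfl⟩)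

variable [Fintype ι]

theorem ellTwoCurry_apply (c : EllTwo (ι × Γ)) (i : ι) (t : Γ) :
    ellTwoCurry ι Γ c i t = c (i, t) := rfl

theorem ellTwoCurry_symm_apply (x : ι → EllTwo Γ) (p : ι × Γ) :
    (ellTwoCurry ι Γ).symm x p = x p.1 p.2 := by
  rw [← ellTwoCurry_apply, ContinuousLinearEquiv.apply_symm_apply]

theorem ellTwoCurry_single [DecidableEq ι] [DecidableEq Γ] (i : ι) (t : Γ) :
    ellTwoCurry ι Γ (lp.single 2 (i, t) (1 : ℂ)) = Pi.single i (lp.single 2 t (1 : ℂ)) := by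
  ext i' t'
  rw [ellTwoCurry_apply, lp.single_apply]
  obtain rfl | hi := eq_or_ne i' i
  · rw [Pi.single_eq_same, lp.single_apply]
    simp [Pi.single_apply]
  · simp [hi]

end EllTwo

section Characters

variable {Γ : Type*} [AddCommGroup Γ] [TopologicalSpace Γ]

theorem pairing_zero (ξ : DualGroup Γ) : pairing 0 ξ = 1 := by
  simp [pairing]

theorem pairing_add (s t : Γ) (ξ : DualGroup Γ) :
    pairing (s + t) ξ = pairing s ξ * pairing t ξ := by
  simp [pairing, ofAdd_add]

theorem pairing_neg (s : Γ) (ξ : DualGroup Γ) : pairing (-s) ξ = conj (pairing s ξ) := by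
  simp [pairing, ofAdd_neg, ← Circle.coe_inv_eq_conj]

theorem pairing_sub (s t : Γ) (ξ : DualGroup Γ) :
    pairing (s - t) ξ = pairing s ξ * conj (pairing t ξ) := by
  rw [sub_eq_add_neg, pairing_add, pairing_neg]

variable [DiscreteTopology Γ]

/-- The conjugate characters as a homomorphism from `Γ` to the continuous functions on its dual;
this makes their linear span a subalgebra. -/
noncomputable def conjCharacterHom (Γ : Type*) [AddCommGroup Γ] [TopologicalSpace Γ]
    [DiscreteTopology Γ] : Multiplicative Γ →* C(DualGroup Γ, ℂ) where
  toFun h := conjCharacter h.toAdd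
  map_one' := by ext ξ; simp [conjCharacter, pairing_zero]
  map_mul' s t := by ext ξ; simp [conjCharacter, pairing_add]

/-- The star algebra of trigonometric polynomials on the dual group. -/
noncomputable def trigPolynomials (Γ : Type*) [AddCommGroup Γ] [TopologicalSpace Γ]
    [DiscreteTopology Γ] : StarSubalgebra ℂ C(DualGroup Γ, ℂ) where
  toSubalgebra := Algebra.adjoin ℂ (MonoidHom.mrange (conjCharacterHom Γ))
  star_mem' {f} hf := by
    suffices h : Algebra.adjoin ℂ (MonoidHom.mrange (conjCharacterHom Γ) : Set C(DualGroup Γ, ℂ)) ≤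
        star (Algebra.adjoin ℂ (MonoidHom.mrange (conjCharacterHom Γ))) from h hf
    refine Algebra.adjoin_le ?_
    rintro - ⟨h, rfl⟩
    refine Algebra.subset_adjoin ⟨h⁻¹, ?_⟩
    ext ξ
    simp [conjCharacterHom, conjCharacter, pairing_neg]

theorem toSubmodule_trigPolynomials :
    Subalgebra.toSubmodule (trigPolynomials Γ).toSubalgebra =
      Submodule.span ℂ (Set.range conjCharacter) := by
  refine (Algebra.adjoin_eq_span ℂ _).trans ?_
  rw [Submonoid.closure_eq, MonoidHom.coe_mrange]
  rfl

theorem separatesPoints_trigPolynomials : (trigPolynomials Γ).SeparatesPoints := by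
  intro ξ η hne
  by_contra! hcon
  refine hne (DFunLike.ext _ _ fun t => Subtype.ext ((starRingEnd ℂ).injective ?_))
  exact hcon _ ⟨conjCharacter t.toAdd, Algebra.subset_adjoin ⟨t, rfl⟩, rfl⟩

theorem span_conjCharacter_closure_eq_top :
    (Submodule.span ℂ (Set.range (conjCharacter (Γ := Γ)))).topologicalClosure = ⊤ := by
  rw [← toSubmodule_trigPolynomials]
  exact congrArg (Subalgebra.toSubmodule <| StarSubalgebra.toSubalgebra ·)
    (ContinuousMap.starSubalgebra_topologicalClosure_eq_top_of_separatesPoints _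
      separatesPoints_trigPolynomials)

instance instRegularDualHaar : (dualHaar Γ).Regular := by
  unfold dualHaar; infer_instance

theorem span_characterL2_closure_eq_top :
    (Submodule.span ℂ (Set.range (characterL2 (Γ := Γ)))).topologicalClosure = ⊤ := by
  have h := (ContinuousMap.toLp_denseRange (p := 2) ℂ (dualHaar Γ) ℂ
    (by simp)).topologicalClosure_map_submodule span_conjCharacter_closure_eq_top
  rwa [Submodule.map_span, ← Set.range_comp] at h

theorem coeFn_characterL2 (h : Γ) :
    (characterL2 h : DualGroup Γ → ℂ) =ᵐ[dualHaar Γ] fun ξ => conj (pairing h ξ) :=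
  ContinuousMap.coeFn_toLp (p := 2) (𝕜 := ℂ) (dualHaar Γ) (conjCharacter h)

/-- The orthonormal basis of `L²(Γ̂)` formed by the conjugate characters. -/
noncomputable def characterBasis (Γ : Type*) [AddCommGroup Γ] [TopologicalSpace Γ]
    [DiscreteTopology Γ] : HilbertBasis Γ ℂ (Lp ℂ 2 (dualHaar Γ)) :=
  HilbertBasis.mk orthonormal_characterL2 span_characterL2_closure_eq_top.ge

theorem coe_characterBasis : ⇑(characterBasis Γ) = characterL2 :=
  HilbertBasis.coe_mk _ _

theorem characterBasis_repr_symm (a : EllTwo Γ) : (characterBasis Γ).repr.symm a = fourier a :=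
  HasSum.unique (by simpa [coe_characterBasis] using (characterBasis Γ).hasSum_repr_symm a)
    (hasSum_fourier a)

theorem fourier_characterBasis_repr (F : Lp ℂ 2 (dualHaar Γ)) :
    fourier ((characterBasis Γ).repr F) = F := by
  rw [← characterBasis_repr_symm, LinearIsometryEquiv.symm_apply_apply]

theorem fourier_single [DecidableEq Γ] (h : Γ) :
    fourier (lp.single 2 h (1 : ℂ)) = characterL2 h := by
  rw [← characterBasis_repr_symm, HilbertBasis.repr_symm_single, coe_characterBasis]

theorem apply_eq_integral_fourier (a : EllTwo Γ) (t : Γ) :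
    a t = ∫ ξ, pairing t ξ * (fourier a : DualGroup Γ → ℂ) ξ ∂(dualHaar Γ) := by
  have inner_eq : inner ℂ (characterL2 t) (fourier a) = a t := by
    rw [← coe_characterBasis, ← HilbertBasis.repr_apply_apply, ← characterBasis_repr_symm,
      LinearIsometryEquiv.apply_symm_apply]
  rw [← inner_eq, L2.inner_def]
  refine integral_congr_ae ?_
  filter_upwards [coeFn_characterL2 t] with ξ hξ
  rw [hξ]
  simp [mul_comm]

end Characters

section EssBounded

variable {Ω : Type*} [MeasurableSpace Ω] {μ : Measure Ω}

/-- The star algebra of essentially bounded functions. Its elements are functions rather than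
almost-everywhere classes, so that evaluation at a point is a homomorphism and determinants of
matrices over it can be computed pointwise. -/
def essBounded (μ : Measure Ω) : StarSubalgebra ℂ (Ω → ℂ) where
  carrier := {f | MemLp f ∞ μ}
  mul_mem' hf hg := hg.mul hf
  add_mem' hf hg := hf.add hg
  algebraMap_mem' c := memLp_top_const c
  star_mem' hf := hf.star

theorem memLp_essBounded (f : essBounded μ) : MemLp (f : Ω → ℂ) ∞ μ := f.2

theorem essBounded_det_apply {ι : Type*} [Fintype ι] [DecidableEq ι]
    (P : Matrix ι ι (essBounded μ)) (x : Ω) :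
    (P.det : Ω → ℂ) x = (P.map fun f => (f : Ω → ℂ) x).det :=
  ((Pi.evalRingHom (fun _ : Ω => ℂ) x).comp
    ((essBounded μ).subtype : essBounded μ →+* (Ω → ℂ))).map_det P

theorem exists_mul_ae_eq_one {f : essBounded μ} {δ : ℝ} (hδ : 0 < δ)
    (hf : ∀ᵐ x ∂μ, δ ≤ ‖(f : Ω → ℂ) x‖) :
    ∃ g : essBounded μ, ((g * f : essBounded μ) : Ω → ℂ) =ᵐ[μ] 1 := by
  have inv_mem : MemLp (f : Ω → ℂ)⁻¹ ∞ μ := by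
    refine memLp_top_of_bound
      (memLp_essBounded f).aestronglyMeasurable.aemeasurable.inv.aestronglyMeasurable δ⁻¹ ?_
    filter_upwards [hf] with x hx
    rw [Pi.inv_apply, norm_inv]
    exact inv_anti₀ hδ hx
  refine ⟨⟨(f : Ω → ℂ)⁻¹, inv_mem⟩, ?_⟩
  filter_upwards [hf] with x hx
  exact inv_mul_cancel₀ (norm_pos_iff.1 (hδ.trans_le hx))

/-- The left inverse is the Moore–Penrose one `(AᴴA)⁻¹ Aᴴ`, with the determinant inverted by a
bounded function. -/
theorem exists_mul_eq_smul_one {κ ι : Type*} [Fintype κ] [Fintype ι] [DecidableEq ι]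
    {A : Matrix κ ι (essBounded μ)} {δ : ℝ} (hδ : 0 < δ)
    (hA : ∀ᵐ x ∂μ, δ ≤ ‖((Aᴴ * A).det : Ω → ℂ) x‖) :
    ∃ (B : Matrix ι κ (essBounded μ)) (u : essBounded μ),
      B * A = u • 1 ∧ (u : Ω → ℂ) =ᵐ[μ] 1 := by
  obtain ⟨v, hv⟩ := exists_mul_ae_eq_one hδ hA
  refine ⟨v • ((Aᴴ * A).adjugate * Aᴴ), v * (Aᴴ * A).det, ?_, hv⟩
  rw [Matrix.smul_mul, Matrix.mul_assoc, Matrix.adjugate_mul, smul_smul]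

variable {p : ℝ≥0∞} [Fact (1 ≤ p)]

/-- Multiplication of `L^p` by an essentially bounded function. -/
noncomputable def mulLp (f : essBounded μ) : Lp ℂ p μ →L[ℂ] Lp ℂ p μ :=
  (ContinuousLinearMap.mul ℂ ℂ).holderL μ ∞ p p (memLp_essBounded f).toLp

theorem coeFn_mulLp (f : essBounded μ) (F : Lp ℂ p μ) :
    (mulLp f F : Ω → ℂ) =ᵐ[μ] fun x => (f : Ω → ℂ) x * F x := by
  filter_upwards [(ContinuousLinearMap.mul ℂ ℂ).coeFn_holder (r := p)
    ((memLp_essBounded f).toLp) F, (memLp_essBounded f).coeFn_toLp] with x h₁ h₂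
  rw [← h₂]
  exact h₁

/-- `mulLp` as a representation of the algebra of essentially bounded functions. -/
noncomputable def mulLpHom (μ : Measure Ω) (p : ℝ≥0∞) [Fact (1 ≤ p)] :
    essBounded μ →+* (Lp ℂ p μ →L[ℂ] Lp ℂ p μ) where
  toFun := mulLp
  map_zero' := by
    ext1 F; refine Lp.ext ?_
    filter_upwards [coeFn_mulLp (0 : essBounded μ) F, Lp.coeFn_zero ℂ p μ] with x h₁ h₂
    simpa [h₁] using h₂.symm
  map_one' := by
    ext1 F; refine Lp.ext ?_
    filter_upwards [coeFn_mulLp (1 : essBounded μ) F] with x h₁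
    simp [h₁]
  map_add' f g := by
    ext1 F; refine Lp.ext ?_
    filter_upwards [coeFn_mulLp (f + g) F, coeFn_mulLp f F, coeFn_mulLp g F,
      Lp.coeFn_add (mulLp f F) (mulLp g F)] with x h₁ h₂ h₃ h₄
    refine h₁.trans (Eq.symm (h₄.trans ?_))
    rw [Pi.add_apply, h₂, h₃]
    exact (add_mul _ _ _).symm
  map_mul' f g := by
    ext1 F; refine Lp.ext ?_
    filter_upwards [coeFn_mulLp (f * g) F, coeFn_mulLp g F, coeFn_mulLp f (mulLp g F)]
      with x h₁ h₂ h₃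
    simp [h₁, h₂, h₃, mul_assoc]

theorem mulLpHom_eq_one {u : essBounded μ} (hu : (u : Ω → ℂ) =ᵐ[μ] 1) : mulLpHom μ p u = 1 := by
  ext1 F; refine Lp.ext ?_
  filter_upwards [coeFn_mulLp u F, hu] with x h₁ h₂
  exact h₁.trans (by simp [h₂])

end EssBounded

section Multiplier

variable {Γ : Type*} [AddCommGroup Γ] [TopologicalSpace Γ] [DiscreteTopology Γ]

/-- The Fourier multipliers on `ℓ²(Γ)`: the bounded function `g` acts as multiplication by `g` on
the Fourier side. -/
noncomputable def multiplier (Γ : Type*) [AddCommGroup Γ] [TopologicalSpace Γ]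
    [DiscreteTopology Γ] : essBounded (dualHaar Γ) →+* (EllTwo Γ →L[ℂ] EllTwo Γ) :=
  RingHom.comp
    ((characterBasis Γ).repr.toContinuousLinearEquiv.conjContinuousAlgEquiv : _ →+* _)
    (mulLpHom (dualHaar Γ) 2)

theorem fourier_multiplier (g : essBounded (dualHaar Γ)) (x : EllTwo Γ) :
    fourier (multiplier Γ g x) = mulLp g (fourier x) := by
  rw [← characterBasis_repr_symm x]
  exact fourier_characterBasis_repr _

theorem multiplier_eq_one {u : essBounded (dualHaar Γ)}
    (hu : (u : DualGroup Γ → ℂ) =ᵐ[dualHaar Γ] 1) : multiplier Γ u = 1 := by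
  rw [multiplier, RingHom.comp_apply, mulLpHom_eq_one hu, map_one]

theorem multiplier_single [DecidableEq Γ] (g : essBounded (dualHaar Γ)) (r t : Γ) :
    multiplier Γ g (lp.single 2 r (1 : ℂ)) t =
      ∫ ξ, pairing (t - r) ξ * (g : DualGroup Γ → ℂ) ξ ∂(dualHaar Γ) := by
  rw [apply_eq_integral_fourier, fourier_multiplier, fourier_single]
  refine integral_congr_ae ?_
  filter_upwards [coeFn_mulLp g (characterL2 r), coeFn_characterL2 r] with ξ h₁ h₂
  rw [h₁, h₂, pairing_sub]
  ring

theorem multiplier_single_sub [DecidableEq Γ] (g : essBounded (dualHaar Γ)) (r t : Γ) :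
    multiplier Γ g (lp.single 2 r (1 : ℂ)) t =
      multiplier Γ g (lp.single 2 0 (1 : ℂ)) (t - r) := by
  rw [multiplier_single, multiplier_single, sub_zero]

theorem hasSum_multiplier {g : essBounded (dualHaar Γ)} {a : EllTwo Γ}
    (hg : (g : DualGroup Γ → ℂ) =ᵐ[dualHaar Γ] fourier a) (x : EllTwo Γ) (t : Γ) :
    HasSum (fun s => a (t - s) * x s) (multiplier Γ g x t) := by
  classical
  have kernel_eq (s : Γ) : multiplier Γ g (lp.single 2 s (1 : ℂ)) t = a (t - s) := by
    rw [multiplier_single, apply_eq_integral_fourier a]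
    exact integral_congr_ae (hg.mono fun ξ hξ => congrArg (pairing (t - s) ξ * ·) hξ)
  refine (hasSum_map_single (lp.evalCLM ℂ (fun _ : Γ => ℂ) 2 t ∘L multiplier Γ g) x).congr_fun
    fun s => ?_
  rw [mul_comm, ← kernel_eq s]
  rfl

variable {ι κ ν : Type*} [Fintype ι] [Fintype κ] [Fintype ν]

/-- The operator `ℓ²(Γ)^ι → ℓ²(Γ)^κ` which on the Fourier side is multiplication by a matrix of
bounded functions, with the finite powers `ℓ²(Γ)^ι` realized as `ℓ²(ι × Γ)`. -/
noncomputable def matrixMultiplier (g : Matrix κ ι (essBounded (dualHaar Γ))) :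
    EllTwo (ι × Γ) →L[ℂ] EllTwo (κ × Γ) :=
  ((ellTwoCurry κ Γ).symm : _ →L[ℂ] EllTwo (κ × Γ)) ∘L
    (ContinuousLinearMap.pi fun m => ∑ i, multiplier Γ (g m i) ∘L
      ContinuousLinearMap.proj (φ := fun _ : ι => EllTwo Γ) i) ∘L
    (ellTwoCurry ι Γ : EllTwo (ι × Γ) →L[ℂ] _)

theorem ellTwoCurry_matrixMultiplier (g : Matrix κ ι (essBounded (dualHaar Γ)))
    (c : EllTwo (ι × Γ)) (m : κ) :
    ellTwoCurry κ Γ (matrixMultiplier g c) m =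
      ∑ i, multiplier Γ (g m i) (ellTwoCurry ι Γ c i) := by
  simp [matrixMultiplier]

theorem matrixMultiplier_apply (g : Matrix κ ι (essBounded (dualHaar Γ)))
    (c : EllTwo (ι × Γ)) (m : κ) (t : Γ) :
    matrixMultiplier g c (m, t) = ∑ i, multiplier Γ (g m i) (ellTwoCurry ι Γ c i) t := by
  rw [← ellTwoCurry_apply, ellTwoCurry_matrixMultiplier, lp.coeFn_sum, Finset.sum_apply]

theorem matrixMultiplier_single [DecidableEq ι] [DecidableEq Γ]
    (g : Matrix κ ι (essBounded (dualHaar Γ))) (i : ι) (r : Γ) :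
    matrixMultiplier g (lp.single 2 (i, r) (1 : ℂ)) =
      ellTwoTranslate r (matrixMultiplier g (lp.single 2 (i, 0) (1 : ℂ))) := by
  ext ⟨m, t⟩
  rw [ellTwoTranslate_apply, matrixMultiplier_apply, matrixMultiplier_apply]
  refine Finset.sum_congr rfl fun i' _ => ?_
  rw [ellTwoCurry_single, ellTwoCurry_single]
  obtain rfl | hi := eq_or_ne i' i
  · rw [Pi.single_eq_same, Pi.single_eq_same, multiplier_single_sub]
  · simp [hi]

theorem matrixMultiplier_mul (f : Matrix ν κ (essBounded (dualHaar Γ)))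
    (g : Matrix κ ι (essBounded (dualHaar Γ))) (c : EllTwo (ι × Γ)) :
    matrixMultiplier (f * g) c = matrixMultiplier f (matrixMultiplier g c) := by
  refine (ellTwoCurry ν Γ).injective (funext fun n => ?_)
  simp only [ellTwoCurry_matrixMultiplier, Matrix.mul_apply, map_sum, map_mul, sum_apply,
    mul_apply_eq_comp]
  exact Finset.sum_comm

theorem matrixMultiplier_smul_one [DecidableEq ι] {u : essBounded (dualHaar Γ)}
    (hu : (u : DualGroup Γ → ℂ) =ᵐ[dualHaar Γ] 1) (c : EllTwo (ι × Γ)) :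
    matrixMultiplier (u • 1 : Matrix ι ι (essBounded (dualHaar Γ))) c = c := by
  refine (ellTwoCurry ι Γ).injective (funext fun i => ?_)
  rw [ellTwoCurry_matrixMultiplier,
    Finset.sum_eq_single i (fun i' _ hi => by simp [hi.symm]) (by simp)]
  simp [multiplier_eq_one hu]

end Multiplier

section StableMatrix

variable {Γ κ ι : Type*} [AddCommGroup Γ] [TopologicalSpace Γ] [DiscreteTopology Γ]
  [Fintype κ] [Fintype ι] [DecidableEq ι] {A : Matrix κ ι (EllTwo Γ)}

open scoped ComplexOrder in
theorem IsStableMatrix.exists_le_norm_det (hA : IsStableMatrix A) :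
    ∃ δ : ℝ, 0 < δ ∧ ∀ᵐ ξ ∂(dualHaar Γ),
      δ ≤ ‖((transferMatrix A ξ)ᴴ * transferMatrix A ξ).det‖ := by
  refine ⟨_, hA.essInf_det_pos, ?_⟩
  have bounded_below : IsBoundedUnder (· ≥ ·) (ae (dualHaar Γ)) fun ξ : DualGroup Γ =>
      ((transferMatrix A ξ)ᴴ * transferMatrix A ξ).det.re :=
    isBoundedUnder_of ⟨0, fun ξ => (Complex.nonneg_iff.1
      (Matrix.posSemidef_conjTranspose_mul_self (transferMatrix A ξ)).det_nonneg).1⟩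
  filter_upwards [ae_essInf_le bounded_below] with ξ hξ
  exact hξ.trans (Complex.re_le_norm _)

open scoped ComplexOrder in
theorem IsStableMatrix.card_le (hA : IsStableMatrix A) : Fintype.card ι ≤ Fintype.card κ := by
  obtain ⟨δ, hδ, hdet⟩ := hA.exists_le_norm_det
  obtain ⟨ξ, hξ⟩ := hdet.exists
  have isUnit_gram : IsUnit ((transferMatrix A ξ)ᴴ * transferMatrix A ξ) := by
    rw [Matrix.isUnit_iff_isUnit_det, isUnit_iff_ne_zero]
    exact norm_pos_iff.1 (hδ.trans_le hξ)
  rw [← Matrix.rank_of_isUnit _ isUnit_gram, Matrix.rank_conjTranspose_mul_self]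
  exact Matrix.rank_le_card_height _

/-- The transfer matrix as a matrix of essentially bounded functions. -/
noncomputable def IsStableMatrix.symbol (hA : IsStableMatrix A) :
    Matrix κ ι (essBounded (dualHaar Γ)) :=
  Matrix.of fun m i => ⟨fourier (A m i), hA.memLp_top m i⟩

theorem IsStableMatrix.matrixMultiplier_symbol_apply (hA : IsStableMatrix A)
    (c : EllTwo (ι × Γ)) (m : κ) (t : Γ) :
    matrixMultiplier hA.symbol c (m, t) = matrixConv A (ellTwoCurry ι Γ c) m t := by
  rw [matrixMultiplier_apply]
  exact Finset.sum_congr rfl fun i _ => (hasSum_multiplier .rfl _ t).tsum_eq.symm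

theorem IsStableMatrix.det_symbol_apply (hA : IsStableMatrix A) (ξ : DualGroup Γ) :
    ((hA.symbolᴴ * hA.symbol).det : DualGroup Γ → ℂ) ξ =
      ((transferMatrix A ξ)ᴴ * transferMatrix A ξ).det := by
  rw [essBounded_det_apply]
  congr 1
  ext i i'
  simp [Matrix.mul_apply, symbol, transferMatrix]

theorem IsStableMatrix.exists_leftInverse (hA : IsStableMatrix A) :
    ∃ B : Matrix ι κ (essBounded (dualHaar Γ)),
      Function.LeftInverse (matrixMultiplier B) (matrixMultiplier hA.symbol) := by
  obtain ⟨δ, hδ, hdet⟩ := hA.exists_le_norm_det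
  simp only [← hA.det_symbol_apply] at hdet
  obtain ⟨B, u, hBA, hu⟩ := exists_mul_eq_smul_one hδ hdet
  exact ⟨B, fun c => by rw [← matrixMultiplier_mul, hBA, matrixMultiplier_smul_one hu]⟩

end StableMatrix

theorem le_sqrt_mul_of_sq_le {x y b : ℝ} (hx : 0 ≤ x) (h : y ^ 2 ≤ b * x ^ 2) : y ≤ √b * x :=
  (Real.le_sqrt_of_sq_le h).trans_eq (by rw [Real.sqrt_mul' _ (sq_nonneg x), Real.sqrt_sq hx])

section Riesz

variable {E K : Type*} [NormedAddCommGroup E] [InnerProductSpace ℂ E] {e : K → E}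

theorem IsRieszSequence.comp_injective {K' : Type*} (he : IsRieszSequence e)
    {v : K' → K} (hv : Function.Injective v) : IsRieszSequence (e ∘ v) := by
  classical
  obtain ⟨a, b, ha, hab, h⟩ := he
  refine ⟨a, b, ha, hab, fun s c => ?_⟩
  simpa [Finset.sum_map, hv.extend_apply] using h (s.map ⟨v, hv⟩) (Function.extend v c 0)

theorem IsRieszSequence.exists_bounds {f : EllTwo K → E} (he : IsRieszSequence e)
    (hf : ∀ c : EllTwo K, HasSum (fun k => c k • e k) (f c)) :
    ∃ a b : ℝ, 0 < a ∧ a ≤ b ∧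
      ∀ c, a * ‖c‖ ^ 2 ≤ ‖f c‖ ^ 2 ∧ ‖f c‖ ^ 2 ≤ b * ‖c‖ ^ 2 := by
  obtain ⟨a, b, ha, hab, h⟩ := he
  exact ⟨a, b, ha, hab, fun c =>
    ⟨le_of_tendsto_of_tendsto' ((hasSum_norm_sq c).const_mul a) ((hf c).norm.pow 2)
        fun s => (h s c).1,
      le_of_tendsto_of_tendsto' ((hf c).norm.pow 2) ((hasSum_norm_sq c).const_mul b)
        fun s => (h s c).2⟩⟩

variable [CompleteSpace E]

theorem IsRieszSequence.summable_smul (he : IsRieszSequence e) (c : EllTwo K) :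
    Summable fun k => c k • e k := by
  obtain ⟨a, b, ha, hab, h⟩ := he
  have hb : 0 < b := ha.trans_le hab
  rw [summable_iff_vanishing_norm]
  intro ε hε
  obtain ⟨s, hs⟩ := summable_iff_vanishing_norm.1 (hasSum_norm_sq c).summable (ε ^ 2 / b)
    (by positivity)
  refine ⟨s, fun t ht => ?_⟩
  have tail_lt := hs t ht
  rw [Real.norm_of_nonneg (Finset.sum_nonneg fun _ _ => by positivity), lt_div_iff₀' hb]
    at tail_lt
  exact (sq_lt_sq₀ (norm_nonneg _) hε.le).1 ((h t c).2.trans_lt tail_lt)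

/-- The synthesis operator `c ↦ ∑ k, c k • e k` of a Riesz sequence. -/
noncomputable def IsRieszSequence.synthesis (he : IsRieszSequence e) : EllTwo K →L[ℂ] E :=
  LinearMap.mkContinuousOfExistsBound
    { toFun c := ∑' k, c k • e k
      map_add' c d := by
        simp only [lp.coeFn_add, Pi.add_apply, add_smul]
        exact (he.summable_smul c).tsum_add (he.summable_smul d)
      map_smul' z c := by
        simp only [lp.coeFn_smul, Pi.smul_apply, smul_assoc, RingHom.id_apply]
        exact (he.summable_smul c).tsum_const_smul z } <| by
    obtain ⟨a, b, -, -, h⟩ := he.exists_bounds fun c => (he.summable_smul c).hasSum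
    exact ⟨√b, fun c => le_sqrt_mul_of_sq_le (norm_nonneg c) (h c).2⟩

theorem IsRieszSequence.hasSum_synthesis (he : IsRieszSequence e) (c : EllTwo K) :
    HasSum (fun k => c k • e k) (he.synthesis c) :=
  (he.summable_smul c).hasSum

theorem IsRieszSequence.exists_antilipschitzWith_synthesis (he : IsRieszSequence e) :
    ∃ C, AntilipschitzWith C he.synthesis := by
  obtain ⟨a, b, ha, -, h⟩ := he.exists_bounds he.hasSum_synthesis
  exact ⟨⟨√a⁻¹, Real.sqrt_nonneg _⟩, AddMonoidHomClass.antilipschitz_of_bound _ fun c =>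
    le_sqrt_mul_of_sq_le (norm_nonneg _) ((le_inv_mul_iff₀ ha).2 (h c).1)⟩

end Riesz

section ContinuousFrame

variable {E Ω : Type*} [NormedAddCommGroup E] [InnerProductSpace ℂ E] [MeasurableSpace Ω]
  {μ : Measure Ω} {ψ : Ω → E}

theorem eLpNorm_two_sq (f : Ω → ℂ) : eLpNorm f 2 μ ^ 2 = ∫⁻ w, ‖f w‖ₑ ^ 2 ∂μ := by
  simpa using eLpNorm_nnreal_pow_eq_lintegral (f := f) (μ := μ) (p := 2) two_ne_zero

theorem lintegral_enorm_sq_eq (F : Lp ℂ 2 μ) {f : Ω → ℂ} (hf : F =ᵐ[μ] f) :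
    ∫⁻ w, ‖f w‖ₑ ^ 2 ∂μ = ENNReal.ofReal (‖F‖ ^ 2) := by
  rw [← enorm_sq_eq_ofReal, Lp.enorm_def, eLpNorm_congr_ae hf, eLpNorm_two_sq]

theorem IsContinuousFrame.memLp (hψ : IsContinuousFrame μ ψ) (f : E) :
    MemLp (fun w => inner ℂ (ψ w) f) 2 μ := by
  obtain ⟨a, b, -, -, hab⟩ := hψ.bounds
  have sq_lt_top := (hab f).2.trans_lt ENNReal.ofReal_lt_top
  rw [← eLpNorm_two_sq] at sq_lt_top
  exact ⟨(hψ.measurable f).aestronglyMeasurable,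
    (ENNReal.pow_lt_top_iff.1 sq_lt_top).resolve_right two_ne_zero⟩

theorem IsContinuousFrame.exists_bounds (hψ : IsContinuousFrame μ ψ) :
    ∃ a b : ℝ, 0 < a ∧ a ≤ b ∧ ∀ f, a * ‖f‖ ^ 2 ≤ ‖(hψ.memLp f).toLp‖ ^ 2 ∧
      ‖(hψ.memLp f).toLp‖ ^ 2 ≤ b * ‖f‖ ^ 2 := by
  obtain ⟨a, b, ha, hab, h⟩ := hψ.bounds
  have hb : 0 < b := ha.trans_le hab
  refine ⟨a, b, ha, hab, fun f => ?_⟩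
  have bounds := h f
  rwa [lintegral_enorm_sq_eq _ (hψ.memLp f).coeFn_toLp,
    ENNReal.ofReal_le_ofReal_iff (by positivity),
    ENNReal.ofReal_le_ofReal_iff (by positivity)] at bounds

/-- The analysis operator `f ↦ ⟨f, ψ ·⟩` of a continuous frame. -/
noncomputable def IsContinuousFrame.analysis (hψ : IsContinuousFrame μ ψ) : E →L[ℂ] Lp ℂ 2 μ :=
  LinearMap.mkContinuousOfExistsBound
    { toFun f := (hψ.memLp f).toLp
      map_add' f g := by
        rw [← MemLp.toLp_add]
        exact MemLp.toLp_congr _ _ (ae_of_all _ fun w => inner_add_right _ _ _)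
      map_smul' z f := by
        rw [RingHom.id_apply, ← MemLp.toLp_const_smul]
        exact MemLp.toLp_congr _ _ (ae_of_all _ fun w => inner_smul_right _ _ _) } <| by
    obtain ⟨a, b, -, -, h⟩ := hψ.exists_bounds
    exact ⟨√b, fun f => le_sqrt_mul_of_sq_le (norm_nonneg f) (h f).2⟩

theorem IsContinuousFrame.coeFn_analysis (hψ : IsContinuousFrame μ ψ) (f : E) :
    (hψ.analysis f : Ω → ℂ) =ᵐ[μ] fun w => inner ℂ (ψ w) f :=
  (hψ.memLp f).coeFn_toLp

theorem IsContinuousFrame.exists_antilipschitzWith_analysis (hψ : IsContinuousFrame μ ψ) :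
    ∃ C, AntilipschitzWith C hψ.analysis := by
  obtain ⟨a, b, ha, -, h⟩ := hψ.exists_bounds
  exact ⟨⟨√a⁻¹, Real.sqrt_nonneg _⟩, AddMonoidHomClass.antilipschitz_of_bound _ fun f =>
    le_sqrt_mul_of_sq_le (norm_nonneg _) ((le_inv_mul_iff₀ ha).2 (h f).1)⟩

end ContinuousFrame

section FrameOfOperator

variable {E F : Type*} [NormedAddCommGroup E] [InnerProductSpace ℂ E] [CompleteSpace E]
  [NormedAddCommGroup F] [InnerProductSpace ℂ F] [CompleteSpace F]

theorem norm_map_le_mul_norm_adjoint (D : E →L[ℂ] F) {C : ℝ} {y : E} (hy : ‖y‖ ≤ C * ‖D y‖) :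
    ‖D y‖ ≤ C * ‖D.adjoint (D y)‖ := by
  obtain h₀ | hpos := (norm_nonneg (D y)).eq_or_lt
  · simp [norm_eq_zero.1 h₀.symm]
  refine le_of_mul_le_mul_right ?_ hpos
  calc ‖D y‖ * ‖D y‖ = ‖inner ℂ (D.adjoint (D y)) y‖ := by
        rw [ContinuousLinearMap.adjoint_inner_left, inner_self_eq_norm_sq_to_K]
        simp [sq]
    _ ≤ ‖D.adjoint (D y)‖ * ‖y‖ := norm_inner_le_norm _ _
    _ ≤ ‖D.adjoint (D y)‖ * (C * ‖D y‖) := by gcongr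
    _ = C * ‖D.adjoint (D y)‖ * ‖D y‖ := by ring

theorem adjoint_apply_eq_inner_single {K : Type*} [DecidableEq K] (D : EllTwo K →L[ℂ] F)
    (f : F) (k : K) : D.adjoint f k = inner ℂ (D (lp.single 2 k (1 : ℂ))) f := by
  rw [← ContinuousLinearMap.adjoint_inner_right, lp.inner_single_left]
  simp

variable {Ω K : Type*} [MeasurableSpace Ω] {μ : Measure Ω} [DecidableEq K]

theorem integral_mul_conj_eq_adjoint_apply (D : EllTwo K →L[ℂ] Lp ℂ 2 μ) {g : Lp ℂ 2 μ}
    {f e : Ω → ℂ} (hg : g =ᵐ[μ] f) {k : K} (he : D (lp.single 2 k (1 : ℂ)) =ᵐ[μ] e) :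
    ∫ t, f t * conj (e t) ∂μ = D.adjoint g k := by
  rw [adjoint_apply_eq_inner_single, L2.inner_def]
  refine integral_congr_ae ?_
  filter_upwards [hg, he] with t hgt het
  simp [hgt, het]

theorem isFrameInL2_of_synthesis {V : Set (Ω → ℂ)} {e : K → Ω → ℂ}
    (D : EllTwo K →L[ℂ] Lp ℂ 2 μ) (he : ∀ k, e k ∈ V)
    (hD : ∀ k, D (lp.single 2 k (1 : ℂ)) =ᵐ[μ] e k) {C : ℝ}
    (hV : ∀ f ∈ V, ∃ y, D y =ᵐ[μ] f ∧ ‖y‖ ≤ C * ‖D y‖) : IsFrameInL2 μ V e := by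
  refine ⟨fun f hf => ?_, he, ((max C 1) ^ 2)⁻¹, ((max C 1) ^ 2)⁻¹ + ‖D.adjoint‖ ^ 2,
    by positivity, le_add_of_nonneg_right (by positivity), fun f hf => ?_⟩
  · obtain ⟨y, hy, -⟩ := hV f hf
    exact (memLp_congr_ae hy).1 (Lp.memLp _)
  obtain ⟨y, hy, hle⟩ := hV f hf
  simp only [fun k => integral_mul_conj_eq_adjoint_apply D hy (hD k)]
  rw [tsum_enorm_sq, lintegral_enorm_sq_eq _ hy, enorm_sq_eq_ofReal,
    ← ENNReal.ofReal_mul (by positivity), ← ENNReal.ofReal_mul (by positivity)]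
  refine ⟨ENNReal.ofReal_le_ofReal ?_, ENNReal.ofReal_le_ofReal ?_⟩
  · rw [inv_mul_le_iff₀ (by positivity), ← mul_pow]
    gcongr
    exact norm_map_le_mul_norm_adjoint D (hle.trans (by gcongr; exact le_max_left C 1))
  · calc ‖D.adjoint (D y)‖ ^ 2 ≤ (‖D.adjoint‖ * ‖D y‖) ^ 2 := by
          gcongr
          exact D.adjoint.le_opNorm _
      _ = ‖D.adjoint‖ ^ 2 * ‖D y‖ ^ 2 := mul_pow _ _ _
      _ ≤ _ := by
          gcongr
          exact le_add_of_nonneg_left (by positivity)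

end FrameOfOperator

section AnalysisFunction

variable {G E : Type*} [AddCommGroup G] [TopologicalSpace G] [NormedAddCommGroup E]
  [InnerProductSpace ℂ E]

theorem analysisFun_sub (U : UnitaryRep G E) (ϕ f g : E) (s : G) :
    analysisFun U ϕ (f - g) s = analysisFun U ϕ f s - analysisFun U ϕ g s :=
  inner_sub_right _ _ _

theorem analysisFun_sum (U : UnitaryRep G E) (ϕ : E) {K : Type*} (T : Finset K) (g : K → E)
    (s : G) : analysisFun U ϕ (∑ k ∈ T, g k) s = ∑ k ∈ T, analysisFun U ϕ (g k) s :=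
  inner_sum _ _ _

theorem analysisFun_smul (U : UnitaryRep G E) (ϕ f : E) (z : ℂ) (s : G) :
    analysisFun U ϕ (z • f) s = z * analysisFun U ϕ f s :=
  inner_smul_right _ _ _

theorem analysisFun_translate (U : UnitaryRep G E) (ϕ f : E) (r s : G) :
    analysisFun U ϕ (U r f) s = analysisFun U ϕ f (s - r) := by
  have window_eq : U s ϕ = U r (U (s - r) ϕ) := by rw [← U.map_add, add_sub_cancel]
  rw [analysisFun, analysisFun, window_eq, LinearIsometryEquiv.inner_map_map]

theorem norm_analysisFun_le (U : UnitaryRep G E) (ϕ f : E) (s : G) :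
    ‖analysisFun U ϕ f s‖ ≤ ‖ϕ‖ * ‖f‖ :=
  (norm_inner_le_norm (𝕜 := ℂ) (U s ϕ) f).trans_eq (by rw [LinearIsometryEquiv.norm_map])

section Convergence

variable {U : UnitaryRep G E} {ϕ : E} {K : Type*} {g : K → E} {f : E}

theorem hasSum_analysisFun (hf : HasSum g f) (s : G) :
    HasSum (fun k => analysisFun U ϕ (g k) s) (analysisFun U ϕ f s) :=
  hf.mapL (innerSL ℂ (U s ϕ))

theorem tendstoUniformly_analysisFun (hf : HasSum g f) :
    TendstoUniformly (fun (T : Finset K) s => ∑ k ∈ T, analysisFun U ϕ (g k) s)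
      (analysisFun U ϕ f) atTop := by
  have tail_tendsto : Tendsto (fun T : Finset K => ‖ϕ‖ * ‖f - ∑ k ∈ T, g k‖) atTop (𝓝 0) := by
    simpa using (tendsto_const_nhds (x := f)).sub hf |>.norm.const_mul ‖ϕ‖
  rw [Metric.tendstoUniformly_iff]
  intro ε hε
  filter_upwards [tail_tendsto.eventually_lt_const hε] with T hT s
  rw [dist_eq_norm, ← analysisFun_sum, ← analysisFun_sub]
  exact (norm_analysisFun_le U ϕ _ s).trans_lt hT

theorem tendsto_eLpNorm_analysisFun [MeasurableSpace G] {μ : Measure G}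
    (hϕ : IsContinuousFrame μ fun t => U t ϕ) (hf : HasSum g f) :
    Tendsto (fun T : Finset K =>
      eLpNorm (fun s => analysisFun U ϕ f s - ∑ k ∈ T, analysisFun U ϕ (g k) s) 2 μ)
      atTop (𝓝 0) := by
  have tail_tendsto : Tendsto (fun T : Finset K => ‖hϕ.analysis (f - ∑ k ∈ T, g k)‖ₑ) atTop
      (𝓝 0) := by
    simpa using ((hϕ.analysis.continuous.tendsto _).comp
      ((tendsto_const_nhds (x := f)).sub hf)).enorm
  refine tail_tendsto.congr fun T => ?_
  rw [Lp.enorm_def, eLpNorm_congr_ae (hϕ.coeFn_analysis _)]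
  simp only [← analysisFun_sum, ← analysisFun_sub]
  rfl

end Convergence

end AnalysisFunction

section RangeSpace

variable {G E Γ ι : Type*} [AddCommGroup G] [TopologicalSpace G]
  [NormedAddCommGroup E] [InnerProductSpace ℂ E] [AddCommGroup Γ]
  {U : UnitaryRep G E} {j : Γ →+ G} {Φ : ι → E}

theorem orbit_add (i : ι) (r t : Γ) : orbit U j Φ (i, r + t) = U (j r) (orbit U j Φ (i, t)) := by
  rw [orbit, orbit, map_add, U.map_add]

theorem IsRieszSequence.synthesis_translate [CompleteSpace E]
    (hΦ : IsRieszSequence (orbit U j Φ)) (r : Γ) (c : EllTwo (ι × Γ)) :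
    hΦ.synthesis (ellTwoTranslate r c) = U (j r) (hΦ.synthesis c) := by
  have translated :=
    (hΦ.hasSum_synthesis c).mapL ((U (j r)).toContinuousLinearEquiv : E →L[ℂ] E)
  have reindexed := ((Equiv.refl ι).prodCongr (Equiv.addLeft r)).hasSum_iff.2
    (hΦ.hasSum_synthesis (ellTwoTranslate r c))
  refine reindexed.unique (translated.congr_fun fun p => ?_)
  change ellTwoTranslate r c (p.1, r + p.2) • orbit U j Φ (p.1, r + p.2) =
    U (j r) (c p • orbit U j Φ p)
  rw [ellTwoTranslate_apply, add_sub_cancel_left, orbit_add, map_smul]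

variable [Finite ι]

theorem mem_generatedSpace_iff {f : E} :
    f ∈ generatedSpace U j Φ ↔
      ∃ c : EllTwo (ι × Γ), HasSum (fun p => c p • orbit U j Φ p) f := by
  cases nonempty_fintype ι
  constructor
  · rintro ⟨x, hx⟩
    refine ⟨(ellTwoCurry ι Γ).symm x, ?_⟩
    simpa only [ellTwoCurry_symm_apply] using! hx
  · rintro ⟨c, hc⟩
    exact ⟨ellTwoCurry ι Γ c, hc⟩

theorem generatedSpace_subset_of_orbit_eq {Γ' ι' : Type*} [AddCommGroup Γ'] [Finite ι']
    {j' : Γ' →+ G} {Φ' : ι' → E} (v : ι' × Γ' ≃ ι × Γ)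
    (hv : ∀ p, orbit U j' Φ' p = orbit U j Φ (v p)) :
    generatedSpace U j Φ ⊆ generatedSpace U j' Φ' := by
  intro f hf
  obtain ⟨c, hc⟩ := mem_generatedSpace_iff.1 hf
  refine mem_generatedSpace_iff.2 ⟨ellTwoComap v v.injective c, ?_⟩
  simpa only [hv, ellTwoComap_apply, Function.comp_def] using v.hasSum_iff.2 hc

theorem rangeSpace_eq_of_orbit_eq {Γ' ι' : Type*} [AddCommGroup Γ'] [Finite ι']
    {j' : Γ' →+ G} {Φ' : ι' → E} (v : ι' × Γ' ≃ ι × Γ)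
    (hv : ∀ p, orbit U j' Φ' p = orbit U j Φ (v p)) (ϕ : E) :
    rangeSpace U ϕ j' Φ' = rangeSpace U ϕ j Φ :=
  congrArg (analysisFun U ϕ '' ·) <|
    (generatedSpace_subset_of_orbit_eq v.symm fun p => by
      rw [hv, v.apply_symm_apply]).antisymm (generatedSpace_subset_of_orbit_eq v hv)

theorem IsRieszSequence.rangeSpace_eq_range [CompleteSpace E]
    (hΦ : IsRieszSequence (orbit U j Φ)) (ϕ : E) :
    rangeSpace U ϕ j Φ = Set.range fun c => analysisFun U ϕ (hΦ.synthesis c) := by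
  have generatedSpace_eq : generatedSpace U j Φ = Set.range hΦ.synthesis := by
    ext f
    exact mem_generatedSpace_iff.trans (exists_congr fun c =>
      ⟨fun hc => (hΦ.hasSum_synthesis c).unique hc, fun hc => hc ▸ hΦ.hasSum_synthesis c⟩)
  rw [rangeSpace, generatedSpace_eq, ← Set.range_comp]
  rfl

end RangeSpace

section Sampling

variable {G E Γ ι κ : Type*} [AddCommGroup G] [TopologicalSpace G]
  [NormedAddCommGroup E] [InnerProductSpace ℂ E] [CompleteSpace E]
  [AddCommGroup Γ] [TopologicalSpace Γ] [DiscreteTopology Γ]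
  [Fintype ι] [Fintype κ] {U : UnitaryRep G E} {j : Γ →+ G} {Φ : ι → E} {ϕ : E}

theorem sample_analysisFun_synthesis [DecidableEq ι] [MeasurableSpace G] {μ : Measure G}
    (hϕ : IsContinuousFrame μ fun t => U t ϕ)
    (hΦ : IsRieszSequence (orbit U j Φ))
    {A : Matrix κ ι (EllTwo Γ)} (hA : IsStableMatrix A) (c : EllTwo (ι × Γ)) (p : κ × Γ) :
    sample U ϕ j Φ A (analysisFun U ϕ (hΦ.synthesis c)) p.1 p.2 =
      matrixMultiplier hA.symbol c p := by
  have expansion : HasExpansion U j Φ (ellTwoCurry ι Γ c) (hΦ.synthesis c) :=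
    hΦ.hasSum_synthesis c
  rw [sample, coefficients_eq hϕ hΦ expansion, ← hA.matrixMultiplier_symbol_apply]

section SamplingVector

variable [DecidableEq Γ] [DecidableEq κ]

/-- The vectors whose `Γ`-translates resynthesize `f` from its samples, when `B` inverts the
sampling operator: the synthesis of the columns of `B`. -/
noncomputable def samplingVector (hΦ : IsRieszSequence (orbit U j Φ))
    (B : Matrix ι κ (essBounded (dualHaar Γ))) (m : κ) : E :=
  hΦ.synthesis (matrixMultiplier B (lp.single 2 (m, 0) (1 : ℂ)))

variable (hΦ : IsRieszSequence (orbit U j Φ)) (B : Matrix ι κ (essBounded (dualHaar Γ)))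

theorem synthesis_matrixMultiplier_single (p : κ × Γ) :
    hΦ.synthesis (matrixMultiplier B (lp.single 2 p (1 : ℂ))) =
      U (j p.2) (samplingVector hΦ B p.1) := by
  rw [matrixMultiplier_single, hΦ.synthesis_translate, samplingVector]

theorem analysisFun_samplingVector_sub (ϕ : E) (p : κ × Γ) (s : G) :
    analysisFun U ϕ (samplingVector hΦ B p.1) (s - j p.2) =
      analysisFun U ϕ (hΦ.synthesis (matrixMultiplier B (lp.single 2 p (1 : ℂ)))) s := by
  rw [synthesis_matrixMultiplier_single, analysisFun_translate]

theorem hasSum_smul_synthesis {B} {A : Matrix κ ι (essBounded (dualHaar Γ))}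
    (hBA : Function.LeftInverse (matrixMultiplier B) (matrixMultiplier A))
    (c : EllTwo (ι × Γ)) :
    HasSum (fun p : κ × Γ => matrixMultiplier A c p •
      hΦ.synthesis (matrixMultiplier B (lp.single 2 p (1 : ℂ)))) (hΦ.synthesis c) := by
  simpa [hBA c] using hasSum_map_single (hΦ.synthesis ∘L matrixMultiplier B) (matrixMultiplier A c)

theorem isFrameInL2_samplingVector [MeasurableSpace G] {μ : Measure G}
    (hϕ : IsContinuousFrame μ fun t => U t ϕ) {B} {A : Matrix κ ι (essBounded (dualHaar Γ))}
    (hBA : Function.LeftInverse (matrixMultiplier B) (matrixMultiplier A)) :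
    IsFrameInL2 μ (rangeSpace U ϕ j Φ)
      fun (p : κ × Γ) s => analysisFun U ϕ (samplingVector hΦ B p.1) (s - j p.2) := by
  obtain ⟨C₁, hC₁⟩ := hΦ.exists_antilipschitzWith_synthesis
  obtain ⟨C₂, hC₂⟩ := hϕ.exists_antilipschitzWith_analysis
  simp only [analysisFun_samplingVector_sub, hΦ.rangeSpace_eq_range]
  refine isFrameInL2_of_synthesis (hϕ.analysis ∘L hΦ.synthesis ∘L matrixMultiplier B)
    (C := ‖matrixMultiplier A‖ * (C₁ * C₂ : NNReal)) (fun p => Set.mem_range_self _)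
    (fun p => hϕ.coeFn_analysis _) ?_
  rintro - ⟨c, rfl⟩
  refine ⟨matrixMultiplier A c, ?_, ?_⟩ <;> simp only [ContinuousLinearMap.comp_apply, hBA c]
  · exact hϕ.coeFn_analysis _
  · calc ‖matrixMultiplier A c‖ ≤ ‖matrixMultiplier A‖ * ‖c‖ := (matrixMultiplier A).le_opNorm c
      _ ≤ ‖matrixMultiplier A‖ * ((C₁ * C₂ : NNReal) * ‖hϕ.analysis (hΦ.synthesis c)‖) := by
          gcongr
          exact (hC₂.comp hC₁).le_mul_norm (map_zero (hϕ.analysis ∘L hΦ.synthesis)) c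
      _ = _ := (mul_assoc _ _ _).symm

end SamplingVector

theorem exists_samplingFunctions [DecidableEq ι] [MeasurableSpace G] {μ : Measure G}
    (hϕ : IsContinuousFrame μ fun t => U t ϕ)
    (hΦ : IsRieszSequence (orbit U j Φ))
    {A : Matrix κ ι (EllTwo Γ)} (hA : IsStableMatrix A) :
    ∃ S : κ → G → ℂ,
      (∀ m, S m ∈ rangeSpace U ϕ j Φ) ∧
      (∀ F ∈ rangeSpace U ϕ j Φ,
        let term : κ × Γ → G → ℂ := fun p s => sample U ϕ j Φ A F p.1 p.2 * S p.1 (s - j p.2)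
        (∀ s, HasSum (fun p => term p s) (F s)) ∧
        TendstoUniformly (fun (T : Finset (κ × Γ)) s => ∑ p ∈ T, term p s) F atTop ∧
        Tendsto (fun T : Finset (κ × Γ) => eLpNorm (fun s => F s - ∑ p ∈ T, term p s) 2 μ)
          atTop (𝓝 0)) ∧
      IsFrameInL2 μ (rangeSpace U ϕ j Φ) (fun (p : κ × Γ) s => S p.1 (s - j p.2)) := by
  classical
  obtain ⟨B, hBA⟩ := hA.exists_leftInverse
  refine ⟨fun m => analysisFun U ϕ (samplingVector hΦ B m), fun m => ?_, fun F hF => ?_,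
    isFrameInL2_samplingVector hΦ hϕ hBA⟩
  · rw [hΦ.rangeSpace_eq_range]
    exact Set.mem_range_self _
  · rw [hΦ.rangeSpace_eq_range] at hF
    obtain ⟨c, rfl⟩ := hF
    simp only [sample_analysisFun_synthesis hϕ hΦ hA, analysisFun_samplingVector_sub,
      ← analysisFun_smul]
    have expansion := hasSum_smul_synthesis hΦ hBA c
    exact ⟨hasSum_analysisFun expansion, tendstoUniformly_analysisFun expansion,
      tendsto_eLpNorm_analysisFun hϕ expansion⟩

end Sampling

section Cosets

/-- The bijection `(i, l, r) ↦ (i, r + h l)` given by representatives `h` of the cosets of `R`. -/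
noncomputable def cosetEquiv {Γ ι τ : Type*} [AddCommGroup Γ] (R : AddSubgroup Γ) (h : τ → Γ)
    (hh : ∀ x : Γ, ∃! l, x - h l ∈ R) : (ι × τ) × R ≃ ι × Γ :=
  Equiv.ofBijective (fun p => (p.1.1, (p.2 : Γ) + h p.1.2)) <| by
    constructor
    · rintro ⟨⟨i, l⟩, r⟩ ⟨⟨i', l'⟩, r'⟩ heq
      obtain ⟨rfl, hrl⟩ : i = i' ∧ (r : Γ) + h l = r' + h l' := Prod.mk.inj heq
      obtain rfl : l = l' := (hh (r + h l)).unique (by simp) (by simp [hrl])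
      simpa using hrl
    · rintro ⟨i, x⟩
      obtain ⟨l, hl, -⟩ := hh x
      exact ⟨((i, l), ⟨_, hl⟩), by simp⟩

theorem orbit_cosetEquiv {G E Γ ι τ : Type*} [AddCommGroup G] [TopologicalSpace G]
    [NormedAddCommGroup E] [InnerProductSpace ℂ E] [AddCommGroup Γ] (U : UnitaryRep G E)
    (j : Γ →+ G) (Φ : ι → E) (R : AddSubgroup Γ) (h : τ → Γ)
    (hh : ∀ x : Γ, ∃! l, x - h l ∈ R) (p : (ι × τ) × R) :
    orbit U (j.comp R.subtype) (fun q : ι × τ => U (j (h q.2)) (Φ q.1)) p =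
      orbit U j Φ (cosetEquiv R h hh p) :=
  (orbit_add (j := j) (Φ := Φ) p.1.1 p.2 (h p.1.2)).symm

end Cosets

end UnitarySampling

theorem corollary3_general
    {G : Type*} [AddCommGroup G] [TopologicalSpace G] [MeasurableSpace G] {μ : Measure G}
    {E : Type*} [NormedAddCommGroup E] [InnerProductSpace ℂ E] [CompleteSpace E]
    {U : UnitaryRep G E} {ϕ : E} (hϕ : IsContinuousFrame μ fun t => U t ϕ)
    {Γ ι τ κ : Type*} [AddCommGroup Γ] [TopologicalSpace Γ] [Fintype ι] [DecidableEq ι]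
    [Fintype τ] [DecidableEq τ] [Fintype κ]
    {j : Γ →+ G} {Φ : ι → E} (hΦ : IsRieszSequence (orbit U j Φ))
    {R : AddSubgroup Γ} [DiscreteTopology R] {h : τ → Γ} (hh : ∀ x : Γ, ∃! l, x - h l ∈ R)
    {A : Matrix κ (ι × τ) (EllTwo R)} (hA : IsStableMatrix A) :
    Fintype.card ι * Fintype.card τ ≤ Fintype.card κ ∧
    ∃ S : κ → G → ℂ,
      (∀ m, S m ∈ rangeSpace U ϕ j Φ) ∧
      (∀ F ∈ rangeSpace U ϕ j Φ,
        let term : κ × R → G → ℂ := fun p s =>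
          sample U ϕ (j.comp R.subtype) (fun q : ι × τ => U (j (h q.2)) (Φ q.1))
            A F p.1 p.2 * S p.1 (s - j p.2)
        (∀ s, HasSum (fun p => term p s) (F s)) ∧
        TendstoUniformly (fun (T : Finset (κ × R)) s => ∑ p ∈ T, term p s) F atTop ∧
        Tendsto (fun T : Finset (κ × R) => eLpNorm (fun s => F s - ∑ p ∈ T, term p s) 2 μ)
          atTop (𝓝 0)) ∧
      IsFrameInL2 μ (rangeSpace U ϕ j Φ) (fun (p : κ × R) s => S p.1 (s - j p.2)) := by
  have orbit_eq := orbit_cosetEquiv U j Φ R h hh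
  have hΨ : IsRieszSequence
      (orbit U (j.comp R.subtype) fun q : ι × τ => U (j (h q.2)) (Φ q.1)) := by
    rw [funext orbit_eq]
    exact hΦ.comp_injective (cosetEquiv R h hh).injective
  rw [← Fintype.card_prod, ← rangeSpace_eq_of_orbit_eq (cosetEquiv R h hh) orbit_eq]
  exact ⟨hA.card_le, exists_samplingFunctions hϕ hΨ hA⟩

theorem corollary3
    {G : Type*} [AddCommGroup G] [TopologicalSpace G] [IsTopologicalAddGroup G]
    [LocallyCompactSpace G] [T2Space G] [MeasurableSpace G] [BorelSpace G]
    (μ : Measure G) [μ.IsAddHaarMeasure] [μ.Regular]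
    {E : Type*} [NormedAddCommGroup E] [InnerProductSpace ℂ E] [CompleteSpace E]
    [TopologicalSpace.SeparableSpace E]
    (U : UnitaryRep G E) (ϕ : E) (hϕ : IsContinuousFrame μ fun t => U t ϕ)
    (H : AddSubgroup G) [Countable H] [DiscreteTopology H]
    (N : ℕ) (Φ : Fin N → E) (hΦ : IsRieszSequence (orbit U H.subtype Φ))
    (R : AddSubgroup H) (L : ℕ) (hL : R.index = L)
    (h : Fin L → H) (hh : ∀ x : H, ∃! l, x - h l ∈ R)
    (M : ℕ) (A : Matrix (Fin M) (Fin N × Fin L) (EllTwo R)) (hA : IsStableMatrix A) :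
    N * L ≤ M ∧
    ∃ S : Fin M → G → ℂ,
      (∀ m, S m ∈ rangeSpace U ϕ H.subtype Φ) ∧
      (∀ F ∈ rangeSpace U ϕ H.subtype Φ,
        let term : Fin M × R → G → ℂ := fun p s =>
          sample U ϕ (H.subtype.comp R.subtype) (fun q : Fin N × Fin L => U (h q.2) (Φ q.1))
            A F p.1 p.2 * S p.1 (s - ((p.2 : H) : G))
        (∀ s, HasSum (fun p => term p s) (F s)) ∧
        TendstoUniformly (fun (T : Finset (Fin M × R)) s => ∑ p ∈ T, term p s) F atTop ∧
        Tendsto (fun T : Finset (Fin M × R) => eLpNorm (fun s => F s - ∑ p ∈ T, term p s) 2 μ)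
          atTop (𝓝 0)) ∧
      IsFrameInL2 μ (rangeSpace U ϕ H.subtype Φ)
        (fun (p : Fin M × R) s => S p.1 (s - ((p.2 : H) : G))) := by
  simpa only [Fintype.card_fin, AddSubgroup.subtype_apply]
    using corollary3_general hϕ hΦ hh hA
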